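/- In online graph coloring, an input of length $n$ reveals the vertices of a graph one by one: the $i$-th request is the set of those earlier vertices that are adjacent to the $i$-th vertex. An algorithm irrevocably assigns a color to each vertex when it is revealed, so that adjacent vertices get different colors. The cost is the number of different colors used, and $\mathrm{OPT}(\sigma)$ is the chromatic number of the graph revealed by the input $\sigma$. A deterministic online algorithm with advice computes its $i$-th answer from the first $i$ requests and from the bits it reads (sequentially, possibly adaptively) of an infinite advice tape, which is prepared by an oracle that knows the whole input; no computational restrictions are imposed. Its advice complexity at $n$ is the largest number of advice bits it reads over all inputs of length at most $n$. A randomized online algorithm $R$ with advice complexity $b(n)$ is a probability distribution over deterministic online algorithms with advice complexity at most $b(n)$. For a function $c:\mathbb{N}\to\mathbb{R}$, $R$ is $c(n)$-competitive if there is a constant $\alpha$ such that $\mathbb{E}[R(\sigma)]\le c(|\sigma|)\cdot \mathrm{OPT}(\sigma)+\alpha$ for every input $\sigma$, where $|\sigma|$ is the length of $\sigma$. Theorem. Let $\varepsilon>0$ be a constant. Every randomized $O(n^{1-\varepsilon})$-competitive online graph coloring algorithm must read $\Omega(n\log n)$ bits of advice. That is, there is a constant $K>0$, depending only on $\varepsilon$,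 such that for every $c$ with $c(n)=O(n^{1-\varepsilon})$ and every randomized $c(n)$-competitive online graph coloring algorithm with advice complexity $b(n)$, one has $b(n)\ge K\, n\log_2 n$ for all sufficiently large $n$. -/

import Mathlib

open MeasureTheory Filter Asymptotics

/-- The content of an (infinite) advice tape. -/
abbrev AdviceTape : Type := ℕ → Bool

/-- A deterministic online algorithm with advice on a tape, for requests in `X` and answers in `Y`.
There are no computational restrictions. The algorithm reads its tape sequentially, and may decide
adaptively, from the requests and the bits seen so far, when to stop reading. -/
structure AdviceAlgorithm (X Y : Type) where
  /-- `answer [x₁, …, xᵢ] φ` is the answer `yᵢ` to the request `xᵢ`. -/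
  answer : List X → AdviceTape → Y
  /-- `read [x₁, …, xᵢ] φ` is the total number of bits of the tape `φ` that have been read when the
  algorithm answers `xᵢ`. -/
  read : List X → AdviceTape → ℕ
  /-- Bits that have been read stay read. -/
  read_mono : ∀ (xs ys : List X) (φ : AdviceTape), xs <+: ys → read xs φ ≤ read ys φ
  /-- How far the algorithm reads is determined by the bits that it reads. -/
  read_congr : ∀ (xs : List X) (φ ψ : AdviceTape),
    (∀ j < read xs φ, φ j = ψ j) → read xs ψ = read xs φ
  /-- An answer is determined by the requests so far and the bits read so far. -/
  answer_congr : ∀ (xs : List X) (φ ψ : AdviceTape),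
    (∀ j < read xs φ, φ j = ψ j) → answer xs ψ = answer xs φ
  /-- The advice tape that the oracle, who sees the whole input, prepares for that input. -/
  oracle : List X → AdviceTape

/-- The answer `y_{i+1}` that the algorithm gives in (zero-based) round `i` on the input `σ`, with
the advice tape prepared for `σ`. -/
def AdviceAlgorithm.output {X Y : Type} (A : AdviceAlgorithm X Y) (σ : List X)
    (i : Fin σ.length) : Y :=
  A.answer (σ.take (i + 1)) (A.oracle σ)

/-- The number of advice bits read while serving the input `σ`. -/
def AdviceAlgorithm.bitsRead {X Y : Type} (A : AdviceAlgorithm X Y) (σ : List X) : ℕ :=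
  A.read σ (A.oracle σ)

/-- Advice complexity: the largest number of advice bits read over all inputs (the request
sequences satisfying `I`) of length at most `n`. -/
noncomputable def AdviceAlgorithm.adviceComplexity {X Y : Type} (A : AdviceAlgorithm X Y)
    (I : List X → Prop) (n : ℕ) : ℕ∞ :=
  ⨆ (σ : List X) (_ : I σ ∧ σ.length ≤ n), (A.bitsRead σ : ℕ∞)

namespace OnlineColoring

/-- A request reveals the next vertex: vertices are numbered `0, 1, 2, …` in order of arrival, and
the request is the set of those earlier vertices that are adjacent to the new one. -/
abbrev Request : Type := Finset ℕ

/-- The inputs of online graph coloring: the `i`-th request is a set of earlier vertices. -/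
def IsInput (σ : List Request) : Prop :=
  ∀ i : Fin σ.length, σ[i] ⊆ Finset.range i

/-- The graph that an input reveals. -/
def graph (σ : List Request) : SimpleGraph (Fin σ.length) :=
  SimpleGraph.fromRel fun i j => (j : ℕ) ∈ σ[i]

/-- The optimal offline cost: the chromatic number of the revealed graph. -/
noncomputable def opt (σ : List Request) : ℕ :=
  (graph σ).chromaticNumber.toNat

/-- The chromatic number of the revealed finite graph is finite, so `opt` is that number. -/
theorem coe_opt (σ : List Request) : (opt σ : ℕ∞) = (graph σ).chromaticNumber :=
  ENat.natCast_toNat (SimpleGraph.chromaticNumber_ne_top_iff_exists.mpr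
    ⟨_, (graph σ).colorable_of_fintype⟩)

/-- A deterministic online graph coloring algorithm with advice: colors are natural numbers, and on
each input (with the advice prepared for it) the answers form a proper coloring. -/
structure Algorithm extends AdviceAlgorithm Request ℕ where
  proper : ∀ σ : List Request, IsInput σ → ∀ i j : Fin σ.length,
    (graph σ).Adj i j → toAdviceAlgorithm.output σ i ≠ toAdviceAlgorithm.output σ j

/-- The cost of an algorithm on an input: the number of different colors that it uses. -/
def Algorithm.cost (A : Algorithm) (σ : List Request) : ℕ :=
  (Finset.univ.image (A.output σ)).card

/-- A randomized online graph coloring algorithm with advice: a probability distribution over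
deterministic ones, given as a random variable on a probability space `(Ω, μ)` for which the cost
on each input is measurable. -/
structure RandomizedAlgorithm {Ω : Type*} [MeasurableSpace Ω] (μ : Measure Ω) where
  isProbabilityMeasure : IsProbabilityMeasure μ
  alg : Ω → Algorithm
  measurable_cost : ∀ σ : List Request, IsInput σ → Measurable fun ω => (alg ω).cost σ

/-- The expected cost on the input `σ`. -/
noncomputable def RandomizedAlgorithm.expectedCost {Ω : Type*} [MeasurableSpace Ω]
    {μ : Measure Ω} (R : RandomizedAlgorithm μ) (σ : List Request) : ℝ :=
  ∫ ω, ((R.alg ω).cost σ : ℝ) ∂μ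

/-- `R` has advice complexity (at most) `b`: it is a distribution over deterministic algorithms
of advice complexity at most `b`. -/
def RandomizedAlgorithm.HasAdviceComplexity {Ω : Type*} [MeasurableSpace Ω]
    {μ : Measure Ω} (R : RandomizedAlgorithm μ) (b : ℕ → ℕ) : Prop :=
  ∀ (ω : Ω) (n : ℕ), (R.alg ω).adviceComplexity IsInput n ≤ (b n : ℕ∞)

/-- `R` is `c`-competitive, where the ratio `c` may depend on the length of the input. The additive
constant may not depend on the input. -/
def RandomizedAlgorithm.IsCompetitive {Ω : Type*} [MeasurableSpace Ω]
    {μ : Measure Ω} (R : RandomizedAlgorithm μ) (c : ℕ → ℝ) : Prop :=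
  ∃ α : ℝ, ∀ σ : List Request, IsInput σ → R.expectedCost σ ≤ c σ.length * opt σ + α

end OnlineColoring

namespace OnlineColoring

/-! Give each of `n` vertices a random set of `m` hidden colors, one of `(p, true)` and `(p, false)`
for each `p`, and a random element of this set as its hidden color. Joining a vertex to the earlier
ones whose hidden color is outside its set makes the hidden colors a proper `2 * m`-coloring, but a
request reveals nothing about the vertex's own choice within its set.

Without advice, fitting into a class with at least `h` indices forces `h` bits of the set, so some
full class fits with probability at most `n / 2 ^ h`; a smaller class contains the index of the
vertex with probability at most `h / m`. Every other round adds a new index to a class with fewer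
than `h`, so `s` colors allow at most `s * h` such rounds (`le_card_lucky`). If `s * h ≤ n / 2`,
half the rounds must be lucky; by `card_lucky_le`, `sum_prod_ite_le` and Markov's inequality this
has probability at most `(2 / τ) ^ n`.

A union bound over tapes costs a factor `2 ^ b`. Unless `b` is of order `n * log τ`, most inputs
need more than `s` colors, and averaging yields one input that is bad for the randomized algorithm.
With `u = n ^ γ`, `h ≈ u`, `m ≈ u ^ 2`, `s = n / u ^ 2` and `τ ≈ √u`, the forced ratio is of order
`n / u ^ 4`, above the allowed `n / u ^ 6`, while `log τ` is of order `log n`. -/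

/-! ### Exponential moments of adapted events -/

open Classical in
/-- Exponential moment bound for the number of rounds in which an event happens, if it has
conditional probability at most `q` in each round, given the past. -/
theorem sum_prod_ite_le {Z : Type} [Fintype Z] [Inhabited Z] (E : (ℕ → Z) → ℕ → Prop)
    (hE : ∀ z z' i, (∀ j ≤ i, z j = z' j) → E z i → E z' i) {t q : ℝ} (ht : 0 ≤ t)
    (n : ℕ) (hq : ∀ z, ∀ i < n, ((Finset.univ.filter fun a => E (Function.update z i a) i).card : ℝ)
      ≤ q * Fintype.card Z) :
    ∑ f : Fin n → Z, ∏ i ∈ Finset.range n,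
        (if E (fun j => if h : j < n then f ⟨j, h⟩ else default) i then t else 1)
      ≤ ((1 + t * q) * Fintype.card Z) ^ n := by
  induction n with
  | zero => simp
  | succ n ih =>
    have ih := ih fun z i hi => hq z i (by omega)
    -- Split off the last round: the first `n` factors ignore it, and the last factor is averaged
    -- with the past fixed.
    rw [← (Fin.snocEquiv fun _ => Z).sum_comp, Fintype.sum_prod_type_right]
    have key : ∀ (g : Fin n → Z), ∑ a : Z, ∏ i ∈ Finset.range (n + 1),
        (if E (fun j => if h : j < n + 1 then (Fin.snocEquiv fun _ => Z) (a, g) ⟨j, h⟩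
          else default) i then t else 1)
        ≤ (∏ i ∈ Finset.range n, (if E (fun j => if h : j < n then g ⟨j, h⟩ else default) i
            then t else 1)) * ((1 + t * q) * Fintype.card Z) := by
      intro g
      set z : ℕ → Z := fun j => if h : j < n then g ⟨j, h⟩ else default with hz
      have hupd : ∀ a : Z, ∀ j ≤ n, (if h : j < n + 1 then
          (Fin.snocEquiv fun _ => Z) (a, g) ⟨j, h⟩ else default) = Function.update z n a j := by
        intro a j hj
        rw [dif_pos (by omega)]
        rcases hj.lt_or_eq with hj | rfl
        · rw [Function.update_of_ne hj.ne]
          have : (⟨j, by omega⟩ : Fin (n + 1)) = Fin.castSucc ⟨j, hj⟩ := rfl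
          simp only [this, Fin.snocEquiv_apply, Fin.snoc_castSucc, hz, dif_pos hj]
        · have : (⟨j, by omega⟩ : Fin (j + 1)) = Fin.last j := rfl
          simp only [this, Fin.snocEquiv_apply, Fin.snoc_last, Function.update_self]
      have hiff : ∀ a : Z, ∀ i ≤ n, E (fun j => if h : j < n + 1 then
          (Fin.snocEquiv fun _ => Z) (a, g) ⟨j, h⟩ else default) i
            ↔ E (Function.update z n a) i := fun a i hi =>
        ⟨hE _ _ _ fun j hj => hupd a j (by omega), hE _ _ _ fun j hj => (hupd a j (by omega)).symm⟩
      have hiff' : ∀ a : Z, ∀ i < n, E (Function.update z n a) i ↔ E z i := by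
        intro a i hi
        have : ∀ j ≤ i, Function.update z n a j = z j := fun j hj =>
          Function.update_of_ne (by omega) _ _
        exact ⟨hE _ _ _ this, hE _ _ _ fun j hj => (this j hj).symm⟩
      calc _ = ∑ a : Z, (∏ i ∈ Finset.range n, (if E z i then t else 1))
              * (if E (Function.update z n a) n then t else 1) := by
            refine Finset.sum_congr rfl fun a _ => ?_
            rw [Finset.prod_range_succ]
            congr 1
            · refine Finset.prod_congr rfl fun i hi => ?_
              have hi := Finset.mem_range.mp hi
              simp only [hiff a i hi.le, hiff' a i hi]
            · simp only [hiff a n le_rfl]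
        _ = (∏ i ∈ Finset.range n, (if E z i then t else 1))
              * ∑ a : Z, (if E (Function.update z n a) n then t else 1) := by
            rw [Finset.mul_sum]
        _ ≤ _ := by
            refine mul_le_mul_of_nonneg_left ?_ (Finset.prod_nonneg fun i _ => by split_ifs <;> simp [ht])
            calc _ ≤ ∑ a : Z, (1 + t * (if E (Function.update z n a) n then 1 else 0)) := by
                  refine Finset.sum_le_sum fun a _ => ?_
                  split_ifs <;> linarith
              _ = Fintype.card Z
                  + t * (Finset.univ.filter fun a => E (Function.update z n a) n).card := by
                  rw [Finset.sum_add_distrib, ← Finset.mul_sum]; simp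
              _ ≤ _ := by nlinarith [mul_le_mul_of_nonneg_left (hq z n (by omega)) ht]
    refine (Finset.sum_le_sum fun g _ => key g).trans ?_
    rw [← Finset.sum_mul, pow_succ]
    refine mul_le_mul_of_nonneg_right ih ?_
    -- The sign of `q` is not given; `hq` at an arbitrary sequence supplies it.
    have h1 := (Nat.cast_nonneg (α := ℝ) _).trans (hq (fun _ => default) n (by omega))
    nlinarith [mul_nonneg ht h1, Nat.cast_nonneg (α := ℝ) (Fintype.card Z)]

/-! ### Hidden colors and lucky rounds -/

/-- A set of Boolean functions that agree on `P` is small. -/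
theorem card_le_of_agree {m h : ℕ} (S : Finset (Fin m → Bool)) (P : Finset (Fin m))
    (hP : h ≤ P.card) (hS : ∀ x ∈ S, ∀ y ∈ S, ∀ p ∈ P, x p = y p) :
    (S.card : ℝ) ≤ 2 ^ m / 2 ^ h := by
  have h1 : S.card ≤ (Finset.univ : Finset ({p // p ∉ P} → Bool)).card := by
    refine Finset.card_le_card_of_injOn (fun x p => x p) (fun _ _ => by simp) ?_
    intro x hx y hy hxy
    funext p
    by_cases hp : p ∈ P
    · exact hS x hx y hy p hp
    · exact congrFun hxy ⟨p, hp⟩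
  have h2 : (Finset.univ : Finset ({p // p ∉ P} → Bool)).card = 2 ^ (m - P.card) := by
    rw [Finset.card_univ, Fintype.card_fun, Fintype.card_subtype_compl]; simp
  rw [le_div_iff₀ (by positivity)]
  have h3 : P.card ≤ m := by simpa using P.card_le_univ
  have : S.card * 2 ^ h ≤ 2 ^ m :=
    calc S.card * 2 ^ h ≤ 2 ^ (m - P.card) * 2 ^ P.card :=
          Nat.mul_le_mul (h1.trans h2.le) (Nat.pow_le_pow_right (by norm_num) hP)
      _ = 2 ^ m := by rw [← pow_add, Nat.sub_add_cancel h3]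
  exact_mod_cast this

/-- The hidden data of a vertex: one half of a set of `2 * m` hidden colors, one color
`(p, x p)` for each `p`, and the index of the hidden color of the vertex. -/
abbrev Hidden (m : ℕ) : Type := (Fin m → Bool) × Fin m

/-- The indices of hidden colors that occur among the first `i` vertices in color class `k`. -/
def classIndices {m : ℕ} (z : ℕ → Hidden m) (col : ℕ → ℕ) (i k : ℕ) : Finset (Fin m) :=
  ((Finset.range i).filter fun j => col j = k).image fun j => (z j).2

/-- Vertex `i` fits into its color class, but the class is full or already contains the hidden
color of `i`. -/
def Lucky {m : ℕ} (h : ℕ) (z : ℕ → Hidden m) (col : ℕ → ℕ) (i : ℕ) : Prop :=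
  (∀ j < i, col j = col i → (z i).1 (z j).2 = (z j).1 (z j).2) ∧
    (h ≤ (classIndices z col i (col i)).card ∨ (z i).2 ∈ classIndices z col i (col i))

theorem classIndices_congr {m : ℕ} {z z' : ℕ → Hidden m} {col col' : ℕ → ℕ} {i : ℕ}
    (hz : ∀ j < i, z j = z' j) (hcol : ∀ j < i, col j = col' j) (k : ℕ) :
    classIndices z col i k = classIndices z' col' i k := by
  unfold classIndices
  rw [Finset.filter_congr (q := fun j => col' j = k)
    fun j hj => by rw [hcol j (Finset.mem_range.mp hj)]]
  refine Finset.image_congr fun j hj => ?_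
  have : j < i := by simpa using (Finset.mem_filter.mp hj).1
  simp only [hz j this]

theorem Lucky.congr {m h : ℕ} {z z' : ℕ → Hidden m} {col col' : ℕ → ℕ} {i : ℕ}
    (hz : ∀ j ≤ i, z j = z' j) (hcol : ∀ j ≤ i, col j = col' j) (hl : Lucky h z col i) :
    Lucky h z' col' i := by
  unfold Lucky at *
  rw [← classIndices_congr (fun j hj => hz j hj.le) (fun j hj => hcol j hj.le), ← hcol i le_rfl,
    ← hz i le_rfl]
  refine ⟨fun j hj => ?_, hl.2⟩
  rw [← hcol j hj.le, ← hz j hj.le]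
  exact hl.1 j hj

open Classical in
/-- If the color of a vertex does not depend on its own hidden color, then luck is rare. -/
theorem card_lucky_le {m h n : ℕ} (hh : 0 < h) (hm : 0 < m) (col : (ℕ → Hidden m) → ℕ → ℕ)
    (hcol : ∀ z z' i, (∀ j < i, z j = z' j) → (z i).1 = (z' i).1 → col z i = col z' i)
    (z : ℕ → Hidden m) (i : ℕ) (hi : i < n) :
    ((Finset.univ.filter fun a =>
        Lucky h (Function.update z i a) (col (Function.update z i a)) i).card : ℝ)
      ≤ (n / 2 ^ h + h / m) * Fintype.card (Hidden m) := by
  -- The color of vertex `i` as a function of its set alone; by `hcol` the index `0` is immaterial.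
  set g : (Fin m → Bool) → ℕ := fun x => col (Function.update z i (x, ⟨0, hm⟩)) i with hg
  have hlt : ∀ a, ∀ j < i, Function.update z i a j = z j := fun a j hj =>
    Function.update_of_ne hj.ne _ _
  have hclt : ∀ a, ∀ j < i, col (Function.update z i a) j = col z j := fun a j hj =>
    hcol _ _ _ (fun l hl => hlt a l (hl.trans hj)) (by rw [hlt a j hj])
  have hci : ∀ a : Hidden m, col (Function.update z i a) i = g a.1 := fun a =>
    hcol _ _ _ (fun l hl => by rw [hlt _ l hl, hlt _ l hl]) (by simp)
  -- Only colors already in use can be full, hence at most `n` of them.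
  set full : Finset ℕ := ((Finset.range i).image (col z)).filter
    fun k => h ≤ (classIndices z (col z) i k).card
  set fits : ℕ → Finset (Fin m → Bool) := fun k => Finset.univ.filter
    fun x => ∀ j < i, col z j = k → x (z j).2 = (z j).1 (z j).2
  have hsub : (Finset.univ.filter fun a =>
        Lucky h (Function.update z i a) (col (Function.update z i a)) i) ⊆
      (full.biUnion fits) ×ˢ (Finset.univ : Finset (Fin m)) ∪
      (Finset.univ.filter fun x => (classIndices z (col z) i (g x)).card < h).biUnion
        fun x => (classIndices z (col z) i (g x)).image fun p => (x, p) := by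
    intro a ha
    obtain ⟨-, ha1, ha2⟩ := Finset.mem_filter.mp ha
    rw [classIndices_congr (hlt a) (hclt a), hci a, Function.update_self] at ha2
    have hfit : a.1 ∈ fits (g a.1) := by
      refine Finset.mem_filter.mpr ⟨Finset.mem_univ _, fun j hj hk => ?_⟩
      have := ha1 j hj (by rw [hclt a j hj, hci a, hk])
      rwa [Function.update_self, hlt a j hj] at this
    rw [Finset.mem_union]
    by_cases hfull : h ≤ (classIndices z (col z) i (g a.1)).card
    · left
      refine Finset.mem_product.mpr ⟨Finset.mem_biUnion.mpr ⟨g a.1, ?_, hfit⟩, Finset.mem_univ _⟩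
      refine Finset.mem_filter.mpr ⟨?_, hfull⟩
      obtain ⟨p, hp⟩ := Finset.card_pos.mp (hh.trans_le hfull)
      obtain ⟨j, hj, -⟩ := Finset.mem_image.mp hp
      exact Finset.mem_image.mpr ⟨j, (Finset.mem_filter.mp hj).1, (Finset.mem_filter.mp hj).2⟩
    · right
      refine Finset.mem_biUnion.mpr ⟨a.1, Finset.mem_filter.mpr ⟨Finset.mem_univ _, by omega⟩, ?_⟩
      exact Finset.mem_image.mpr ⟨a.2, ha2.resolve_left hfull, rfl⟩
  have hfits : ∀ k ∈ full, ((fits k).card : ℝ) ≤ 2 ^ m / 2 ^ h := by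
    intro k hk
    refine card_le_of_agree _ (classIndices z (col z) i k) (Finset.mem_filter.mp hk).2 ?_
    intro x hx y hy p hp
    obtain ⟨j, hj, rfl⟩ := Finset.mem_image.mp hp
    obtain ⟨hj1, hj2⟩ := Finset.mem_filter.mp hj
    have hj1 := Finset.mem_range.mp hj1
    rw [(Finset.mem_filter.mp hx).2 j hj1 hj2, (Finset.mem_filter.mp hy).2 j hj1 hj2]
  have hfullcard : full.card ≤ n :=
    (Finset.card_filter_le _ _).trans (Finset.card_image_le.trans (by simp; omega))
  have h1 : (((full.biUnion fits) ×ˢ (Finset.univ : Finset (Fin m))).card : ℝ)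
      ≤ n * (2 ^ m / 2 ^ h) * m := by
    rw [Finset.card_product, Nat.cast_mul, Finset.card_univ, Fintype.card_fin]
    refine mul_le_mul_of_nonneg_right ?_ (by positivity)
    calc ((full.biUnion fits).card : ℝ) ≤ ∑ k ∈ full, ((fits k).card : ℝ) := by
          exact_mod_cast Finset.card_biUnion_le
      _ ≤ ∑ k ∈ full, (2 ^ m / 2 ^ h : ℝ) := Finset.sum_le_sum hfits
      _ = full.card * (2 ^ m / 2 ^ h) := by simp
      _ ≤ _ := by
          refine mul_le_mul_of_nonneg_right ?_ (by positivity)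
          exact_mod_cast hfullcard
  have h2 : ((((Finset.univ.filter fun x => (classIndices z (col z) i (g x)).card < h).biUnion
        fun x => (classIndices z (col z) i (g x)).image fun p => (x, p)).card : ℕ) : ℝ)
      ≤ 2 ^ m * h := by
    have : ((Finset.univ.filter fun x => (classIndices z (col z) i (g x)).card < h).biUnion
        fun x => (classIndices z (col z) i (g x)).image fun p => (x, p)).card ≤ 2 ^ m * h := by
      refine (Finset.card_biUnion_le_card_mul _ _ h fun x hx => ?_).trans ?_
      · exact Finset.card_image_le.trans (Finset.mem_filter.mp hx).2.le
      · refine Nat.mul_le_mul_right _ ((Finset.card_filter_le _ _).trans ?_)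
        simp
    exact_mod_cast this
  have h3 : (Fintype.card (Hidden m) : ℝ) = 2 ^ m * m := by simp
  have hm' : (m : ℝ) ≠ 0 := by positivity
  calc _ ≤ (n * (2 ^ m / 2 ^ h) * m : ℝ) + 2 ^ m * h := by
        refine le_trans ?_ (add_le_add h1 h2)
        exact_mod_cast (Finset.card_le_card hsub).trans (Finset.card_union_le _ _)
    _ = _ := by rw [h3]; field_simp

open Classical in
/-- Few colors force much luck. -/
theorem le_card_lucky {m h n : ℕ} (z : ℕ → Hidden m) (col : ℕ → ℕ)
    (hproper : ∀ i < n, ∀ j < i, col j = col i → (z i).1 (z j).2 = (z j).1 (z j).2) :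
    n ≤ ((Finset.range n).filter fun i => Lucky h z col i).card
      + ((Finset.range n).image col).card * h := by
  have h1 := Finset.card_filter_add_card_filter_not (s := Finset.range n)
    (p := fun i => Lucky h z col i)
  rw [Finset.card_range] at h1
  have h2 : ((Finset.range n).filter fun i => ¬ Lucky h z col i).card
      ≤ (((Finset.range n).image col) ×ˢ Finset.range h).card := by
    have hnot : ∀ i ∈ ((Finset.range n).filter fun i => ¬ Lucky h z col i),
        (classIndices z col i (col i)).card < h ∧ (z i).2 ∉ classIndices z col i (col i) := by
      intro i hi
      obtain ⟨hi, hl⟩ := Finset.mem_filter.mp hi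
      unfold Lucky at hl
      have := hproper i (Finset.mem_range.mp hi)
      push Not at hl
      exact hl this
    -- An unlucky round adds a new index to its class, so within a class the size before the round
    -- identifies it.
    have hmono : ∀ i ∈ ((Finset.range n).filter fun i => ¬ Lucky h z col i), ∀ j, i < j →
        col i = col j →
        (classIndices z col i (col i)).card < (classIndices z col j (col j)).card := by
      intro i hi j hij hc
      refine Finset.card_lt_card (Finset.ssubset_iff_of_subset ?_ |>.mpr
        ⟨(z i).2, ?_, (hnot i hi).2⟩)
      · rw [hc]
        refine Finset.image_subset_image (Finset.filter_subset_filter _ ?_)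
        exact Finset.range_subset_range.mpr hij.le
      · exact Finset.mem_image.mpr ⟨i, by simp [hij, hc], rfl⟩
    refine Finset.card_le_card_of_injOn (fun i => (col i, (classIndices z col i (col i)).card)) ?_ ?_
    · intro i hi
      refine Finset.mem_product.mpr ⟨Finset.mem_image_of_mem _ (Finset.mem_filter.mp hi).1, ?_⟩
      exact Finset.mem_range.mpr (hnot i hi).1
    · intro i hi j hj hij
      obtain ⟨hc, hk⟩ := Prod.ext_iff.mp hij
      dsimp only at hc hk
      rcases lt_trichotomy i j with hlt | heq | hlt
      · exact absurd hk (hmono i hi j hlt hc).ne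
      · exact heq
      · exact absurd hk (hmono j hj i hlt hc.symm).ne'
  rw [Finset.card_product, Finset.card_range] at h2
  omega

/-- The sequence that extends `f` by a default value. -/
def extend {m n : ℕ} (hm : 0 < m) (f : Fin n → Hidden m) : ℕ → Hidden m :=
  fun j => if h : j < n then f ⟨j, h⟩ else (fun _ => false, ⟨0, hm⟩)

open Classical in
/-- An online coloring without advice rarely is proper and uses few colors. -/
theorem card_few_colors_le {m h n : ℕ} (hh : 0 < h) (hm : 0 < m) (col : (ℕ → Hidden m) → ℕ → ℕ)
    (hcol : ∀ z z' i, (∀ j < i, z j = z' j) → (z i).1 = (z' i).1 → col z i = col z' i)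
    {s τ : ℝ} (hs : 2 * (s * h) ≤ n) (hτ : 1 ≤ τ) (hq : τ ^ 2 * (n / 2 ^ h + h / m) ≤ 1) :
    ((Finset.univ.filter fun f : Fin n → Hidden m =>
        (∀ i < n, ∀ j < i, col (extend hm f) j = col (extend hm f) i →
          (extend hm f i).1 (extend hm f j).2 = (extend hm f j).1 (extend hm f j).2) ∧
        (((Finset.range n).image (col (extend hm f))).card : ℝ) ≤ s).card : ℝ) * τ ^ n
      ≤ 2 ^ n * Fintype.card (Fin n → Hidden m) := by
  let _ : Inhabited (Hidden m) := ⟨(fun _ => false, ⟨0, hm⟩)⟩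
  have hmain := sum_prod_ite_le (fun z i => Lucky h z (col z) i)
    (fun z z' i hz => Lucky.congr hz fun j hj => hcol _ _ _ (fun l hl => hz l (by omega))
      (by rw [hz j hj])) (sq_nonneg τ) n (fun z i hi => card_lucky_le hh hm col hcol z i hi)
  have hle : ∀ f ∈ (Finset.univ.filter fun f : Fin n → Hidden m =>
        (∀ i < n, ∀ j < i, col (extend hm f) j = col (extend hm f) i →
          (extend hm f i).1 (extend hm f j).2 = (extend hm f j).1 (extend hm f j).2) ∧
        (((Finset.range n).image (col (extend hm f))).card : ℝ) ≤ s),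
      τ ^ n ≤ ∏ i ∈ Finset.range n,
        (if Lucky h (extend hm f) (col (extend hm f)) i then τ ^ 2 else 1) := by
    intro f hf
    obtain ⟨-, h1, h2⟩ := Finset.mem_filter.mp hf
    have h3 : (n : ℝ) ≤ ((Finset.range n).filter
        fun i => Lucky h (extend hm f) (col (extend hm f)) i).card
        + ((Finset.range n).image (col (extend hm f))).card * h := by
      exact_mod_cast le_card_lucky (h := h) _ _ h1
    rw [Finset.prod_ite, Finset.prod_const, Finset.prod_const_one, mul_one, ← pow_mul]
    refine pow_le_pow_right₀ hτ ?_
    have h4 := mul_le_mul_of_nonneg_right h2 (Nat.cast_nonneg (α := ℝ) h)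
    -- At most `s * h ≤ n / 2` rounds are unlucky; the weight `τ ^ 2` per lucky round compensates
    -- for this half.
    have : (n : ℝ) ≤ 2 * ((Finset.range n).filter
        fun i => Lucky h (extend hm f) (col (extend hm f)) i).card := by linarith
    exact_mod_cast this
  rw [← nsmul_eq_mul]
  refine (Finset.card_nsmul_le_sum _ _ _ hle).trans ?_
  refine (Finset.sum_le_univ_sum_of_nonneg fun f => ?_).trans ?_
  · exact Finset.prod_nonneg fun i _ => by split_ifs <;> positivity
  refine hmain.trans ?_
  rw [mul_pow, Fintype.card_fun (α := Fin n), Fintype.card_fin]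
  push_cast
  -- By `hq`, each round contributes a factor of at most `1 + 1 = 2`.
  refine mul_le_mul_of_nonneg_right (pow_le_pow_left₀ (by positivity) (by linarith) _) ?_
  positivity


/-! ### The hard inputs and colorings from a fixed tape -/

/-- The request for vertex `i`: it is adjacent to those earlier vertices whose hidden color is not
in the set of vertex `i`. -/
def reveal {m : ℕ} (z : ℕ → Hidden m) (i : ℕ) : Request :=
  (Finset.range i).filter fun j => (z i).1 (z j).2 ≠ (z j).1 (z j).2

/-- The input that consists of the first `n` requests. -/
def inputOf {m : ℕ} (z : ℕ → Hidden m) (n : ℕ) : List Request :=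
  (List.range n).map (reveal z)

theorem length_inputOf {m : ℕ} (z : ℕ → Hidden m) (n : ℕ) : (inputOf z n).length = n := by
  simp [inputOf]

theorem getElem_inputOf {m : ℕ} (z : ℕ → Hidden m) (n i : ℕ) (hi : i < (inputOf z n).length) :
    (inputOf z n)[i] = reveal z i := by
  simp [inputOf]

theorem take_inputOf {m : ℕ} (z : ℕ → Hidden m) {k n : ℕ} (hk : k ≤ n) :
    (inputOf z n).take k = inputOf z k := by
  rw [inputOf, ← List.map_take, List.take_range, min_eq_left hk, inputOf]

theorem isInput_inputOf {m : ℕ} (z : ℕ → Hidden m) (n : ℕ) : IsInput (inputOf z n) := by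
  intro i
  rw [Fin.getElem_fin, getElem_inputOf]
  exact Finset.filter_subset _ _

/-- The index of a vertex influences only later requests. -/
theorem reveal_congr {m : ℕ} {z z' : ℕ → Hidden m} {i : ℕ} (h : ∀ j < i, z j = z' j)
    (hi : (z i).1 = (z' i).1) : reveal z i = reveal z' i := by
  refine Finset.filter_congr fun j hj => ?_
  rw [h j (Finset.mem_range.mp hj), hi]

theorem inputOf_congr {m : ℕ} {z z' : ℕ → Hidden m} {i : ℕ} (h : ∀ j < i, z j = z' j)
    (hi : (z i).1 = (z' i).1) : inputOf z (i + 1) = inputOf z' (i + 1) := by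
  refine List.map_congr_left fun j hj => ?_
  rcases Nat.lt_succ_iff_lt_or_eq.mp (List.mem_range.mp hj) with hj | rfl
  · exact reveal_congr (fun l hl => h l (hl.trans hj)) (by rw [h j hj])
  · exact reveal_congr h hi

/-- Each vertex's hidden color lies in its own set, so vertices sharing a hidden color are never
joined. -/
theorem opt_inputOf_le {m : ℕ} (z : ℕ → Hidden m) (n : ℕ) : opt (inputOf z n) ≤ 2 * m := by
  let C : (graph (inputOf z n)).Coloring (Fin m × Bool) :=
    SimpleGraph.Coloring.mk (fun i => ((z i).2, (z i).1 (z i).2)) (by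
      intro i j hij heq
      obtain ⟨h1, h2⟩ := Prod.ext_iff.mp heq
      dsimp only at h1 h2
      obtain ⟨-, h | h⟩ := hij
      all_goals
        rw [Fin.getElem_fin, getElem_inputOf] at h
        refine (Finset.mem_filter.mp h).2 ?_
      · rw [← h1, h2, h1]
      · rw [h1, ← h2, ← h1])
  have h := C.colorable.chromaticNumber_le
  rw [← coe_opt] at h
  have h := Nat.cast_le.mp h
  simpa [mul_comm] using h

/-- The coloring produced online with a fixed advice tape. -/
def colorWith {m : ℕ} (A : Algorithm) (φ : AdviceTape) (z : ℕ → Hidden m) (i : ℕ) : ℕ :=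
  A.answer (inputOf z (i + 1)) φ

/-- Supplies `hcol` in `card_few_colors_le`: with the tape fixed, nothing can hint at the current
hidden color. -/
theorem colorWith_congr {m : ℕ} (A : Algorithm) (φ : AdviceTape) (z z' : ℕ → Hidden m) (i : ℕ)
    (h : ∀ j < i, z j = z' j) (hi : (z i).1 = (z' i).1) :
    colorWith A φ z i = colorWith A φ z' i := by
  rw [colorWith, inputOf_congr h hi, colorWith]

/-- The tape that starts with `a` and continues with zeros. -/
def tapeOf {b : ℕ} (a : Fin b → Bool) : AdviceTape :=
  fun j => if h : j < b then a ⟨j, h⟩ else false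

/-- With at most `b` bits of advice, the answers agree with those of one of `2 ^ b` tapes. -/
theorem exists_tape {m : ℕ} (A : Algorithm) (z : ℕ → Hidden m) {n b : ℕ}
    (hb : A.adviceComplexity IsInput n ≤ (b : ℕ∞)) :
    ∃ a : Fin b → Bool, ∀ i : Fin (inputOf z n).length,
      A.output (inputOf z n) i = colorWith A (tapeOf a) z i := by
  -- The first `b` bits of the true tape; no bit of the zero padding is ever read.
  refine ⟨fun j => A.oracle (inputOf z n) j, fun i => ?_⟩
  have hi : (i : ℕ) < n := i.2.trans_eq (length_inputOf z n)
  have hread : A.bitsRead (inputOf z n) ≤ b := by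
    refine Nat.cast_le.mp (le_trans ?_ hb)
    exact le_iSup₂ (f := fun (σ : List Request) (_ : IsInput σ ∧ σ.length ≤ n) =>
      (A.bitsRead σ : ℕ∞)) (inputOf z n) ⟨isInput_inputOf z n, (length_inputOf z n).le⟩
  rw [colorWith, ← take_inputOf z (Nat.succ_le_of_lt hi)]
  refine (A.answer_congr _ _ _ fun j hj => ?_).symm
  have : j < b := (hj.trans_le (A.read_mono _ _ _ (List.take_prefix _ _))).trans_le hread
  rw [tapeOf, dif_pos this]

theorem cost_eq_of_output_eq {m : ℕ} (A : Algorithm) (φ : AdviceTape) (z : ℕ → Hidden m) {n : ℕ}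
    (h : ∀ i : Fin (inputOf z n).length, A.output (inputOf z n) i = colorWith A φ z i) :
    A.cost (inputOf z n) = ((Finset.range n).image (colorWith A φ z)).card := by
  rw [Algorithm.cost]
  congr 1
  ext k
  simp only [Finset.mem_image, Finset.mem_univ, true_and, Finset.mem_range]
  constructor
  · rintro ⟨i, rfl⟩
    exact ⟨i, i.2.trans_eq (length_inputOf z n), (h i).symm⟩
  · rintro ⟨i, hi, rfl⟩
    exact ⟨⟨i, hi.trans_eq (length_inputOf z n).symm⟩, h _⟩

/-- A tape meant for another input may give an improper coloring; properness is inherited only where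
the coloring is the actual output. Hence the properness clause in `card_few_colors_le`. -/
theorem agree_of_output_eq {m : ℕ} (A : Algorithm) (φ : AdviceTape) (z : ℕ → Hidden m) {n : ℕ}
    (h : ∀ i : Fin (inputOf z n).length, A.output (inputOf z n) i = colorWith A φ z i)
    (i : ℕ) (hi : i < n) (j : ℕ) (hj : j < i) (hc : colorWith A φ z j = colorWith A φ z i) :
    (z i).1 (z j).2 = (z j).1 (z j).2 := by
  by_contra hne
  have hi' : i < (inputOf z n).length := hi.trans_eq (length_inputOf z n).symm
  have hadj : (graph (inputOf z n)).Adj ⟨i, hi'⟩ ⟨j, hj.trans hi'⟩ := by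
    refine ⟨fun heq => hj.ne' (Fin.mk.inj_iff.mp heq), Or.inl ?_⟩
    change j ∈ (inputOf z n)[i]
    rw [getElem_inputOf]
    exact Finset.mem_filter.mpr ⟨Finset.mem_range.mpr hj, hne⟩
  refine A.proper _ (isInput_inputOf z n) _ _ hadj ?_
  rw [h, h]
  exact hc.symm

theorem Algorithm.cost_le_length (A : Algorithm) (σ : List Request) : A.cost σ ≤ σ.length :=
  Finset.card_image_le.trans (by simp)

/-! ### Union bound over tapes and averaging over inputs -/

/-- With little advice, a deterministic algorithm uses few colors on few of the inputs. -/
theorem card_cost_le {m h n b : ℕ} (hh : 0 < h) (hm : 0 < m) (A : Algorithm)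
    (hb : A.adviceComplexity IsInput n ≤ (b : ℕ∞))
    {s τ : ℝ} (hs : 2 * (s * h) ≤ n) (hτ : 1 ≤ τ) (hq : τ ^ 2 * (n / 2 ^ h + h / m) ≤ 1) :
    ((Finset.univ.filter fun f : Fin n → Hidden m =>
        (A.cost (inputOf (extend hm f) n) : ℝ) ≤ s).card : ℝ) * τ ^ n
      ≤ 2 ^ b * (2 ^ n * Fintype.card (Fin n → Hidden m)) := by
  classical
  set few : (Fin b → Bool) → Finset (Fin n → Hidden m) := fun a => Finset.univ.filter fun f =>
        (∀ i < n, ∀ j < i, colorWith A (tapeOf a) (extend hm f) j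
            = colorWith A (tapeOf a) (extend hm f) i →
          (extend hm f i).1 (extend hm f j).2 = (extend hm f j).1 (extend hm f j).2) ∧
        (((Finset.range n).image (colorWith A (tapeOf a) (extend hm f))).card : ℝ) ≤ s
  have hsub : (Finset.univ.filter fun f : Fin n → Hidden m =>
        (A.cost (inputOf (extend hm f) n) : ℝ) ≤ s) ⊆ Finset.univ.biUnion few := by
    intro f hf
    obtain ⟨a, ha⟩ := exists_tape A (extend hm f) hb
    refine Finset.mem_biUnion.mpr ⟨a, Finset.mem_univ _, Finset.mem_filter.mpr
      ⟨Finset.mem_univ _, agree_of_output_eq A _ _ ha, ?_⟩⟩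
    rw [← cost_eq_of_output_eq A _ _ ha]
    exact (Finset.mem_filter.mp hf).2
  have hτ0 : 0 ≤ τ ^ n := by positivity
  calc _ ≤ (∑ a, ((few a).card : ℝ)) * τ ^ n := by
        refine mul_le_mul_of_nonneg_right ?_ hτ0
        exact_mod_cast (Finset.card_le_card hsub).trans Finset.card_biUnion_le
    _ = ∑ a, ((few a).card : ℝ) * τ ^ n := Finset.sum_mul _ _ _
    _ ≤ ∑ a : Fin b → Bool, (2 ^ n * Fintype.card (Fin n → Hidden m) : ℝ) :=
        Finset.sum_le_sum fun a _ => card_few_colors_le hh hm (colorWith A (tapeOf a))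
          (colorWith_congr A _) hs hτ hq
    _ = _ := by simp

/-- With little advice, a randomized algorithm has large expected cost on some input. -/
theorem exists_large_expectedCost {Ω : Type*} [MeasurableSpace Ω] {μ : Measure Ω}
    (R : RandomizedAlgorithm μ) {b : ℕ → ℕ} (hR : R.HasAdviceComplexity b)
    {m h n : ℕ} (hh : 0 < h) (hm : 0 < m) {s τ : ℝ} (hs0 : 0 ≤ s) (hs : 2 * (s * h) ≤ n)
    (hτ : 1 ≤ τ) (hq : τ ^ 2 * (n / 2 ^ h + h / m) ≤ 1) (hb : (2 : ℝ) ^ (b n + n + 1) ≤ τ ^ n) :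
    ∃ z : ℕ → Hidden m, s / 2 ≤ R.expectedCost (inputOf z n) := by
  have := R.isProbabilityMeasure
  set N : ℝ := (Fintype.card (Fin n → Hidden m) : ℝ) with hN
  have hNpos : 0 < N := by
    have : Nonempty (Fin n → Hidden m) := ⟨fun _ => (fun _ => false, ⟨0, hm⟩)⟩
    exact Nat.cast_pos.mpr Fintype.card_pos
  have hpoint : ∀ ω, s / 2 * N
      ≤ ∑ f : Fin n → Hidden m, ((R.alg ω).cost (inputOf (extend hm f) n) : ℝ) := by
    intro ω
    have hτpos : 0 < τ ^ n := by positivity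
    have hfew : ((Finset.univ.filter fun f : Fin n → Hidden m =>
        ((R.alg ω).cost (inputOf (extend hm f) n) : ℝ) ≤ s).card : ℝ) ≤ N / 2 := by
      have h1 := card_cost_le hh hm (R.alg ω) (hR ω n) hs hτ hq
      rw [← mul_le_mul_iff_left₀ hτpos]
      refine h1.trans ?_
      -- The exponent pays for the tapes (`b n`), the moment bound (`n`) and the passage to half of
      -- the inputs (`1`).
      calc (2 : ℝ) ^ b n * (2 ^ n * N) = N / 2 * 2 ^ (b n + n + 1) := by ring
        _ ≤ _ := mul_le_mul_of_nonneg_left hb (by positivity)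
    have hsplit := Finset.card_filter_add_card_filter_not (s := Finset.univ)
      (p := fun f : Fin n → Hidden m => ((R.alg ω).cost (inputOf (extend hm f) n) : ℝ) ≤ s)
    rw [Finset.card_univ] at hsplit
    have hsplit := (Nat.cast_add (R := ℝ) _ _).symm.trans (congrArg Nat.cast hsplit)
    rw [← hN] at hsplit
    calc s / 2 * N ≤ ((Finset.univ.filter fun f : Fin n → Hidden m =>
          ¬ ((R.alg ω).cost (inputOf (extend hm f) n) : ℝ) ≤ s).card : ℝ) * s := by
          nlinarith
      _ ≤ ∑ f ∈ Finset.univ.filter fun f : Fin n → Hidden m =>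
          ¬ ((R.alg ω).cost (inputOf (extend hm f) n) : ℝ) ≤ s,
            ((R.alg ω).cost (inputOf (extend hm f) n) : ℝ) := by
          rw [← nsmul_eq_mul]
          exact Finset.card_nsmul_le_sum _ _ _ fun f hf =>
            (not_le.mp (Finset.mem_filter.mp hf).2).le
      _ ≤ _ := Finset.sum_le_univ_sum_of_nonneg fun f => Nat.cast_nonneg _
  have hint : ∀ f : Fin n → Hidden m,
      Integrable (fun ω => ((R.alg ω).cost (inputOf (extend hm f) n) : ℝ)) μ := by
    intro f
    refine Integrable.of_bound (C := n) ?_ (ae_of_all _ fun ω => ?_)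
    · exact (measurable_from_nat.comp
        (R.measurable_cost _ (isInput_inputOf _ _))).aestronglyMeasurable
    · rw [Real.norm_natCast]
      exact_mod_cast ((R.alg ω).cost_le_length _).trans_eq (length_inputOf _ _)
  have hsum : s / 2 * N ≤ ∑ f : Fin n → Hidden m, R.expectedCost (inputOf (extend hm f) n) := by
    calc s / 2 * N = ∫ _, s / 2 * N ∂μ := by simp
      _ ≤ ∫ ω, ∑ f : Fin n → Hidden m, ((R.alg ω).cost (inputOf (extend hm f) n) : ℝ) ∂μ :=
          integral_mono (integrable_const _) (integrable_finsetSum _ fun f _ => hint f) hpoint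
      _ = _ := integral_finsetSum _ fun f _ => hint f
  by_contra! hlt
  refine hsum.not_gt ?_
  calc _ < ∑ f : Fin n → Hidden m, s / 2 := by
        refine Finset.sum_lt_sum_of_nonempty ?_ fun f _ => hlt _
        exact ⟨fun _ => (fun _ => false, ⟨0, hm⟩), Finset.mem_univ _⟩
    _ = s / 2 * N := by simp [hN, mul_comm]

/-! ### Choice of parameters and asymptotics -/

theorem eventually_mul_rpow_le_two_rpow {γ : ℝ} (hγ : 0 < γ) :
    ∀ᶠ n : ℕ in atTop, (n : ℝ) * (n : ℝ) ^ γ ≤ 2 ^ ((n : ℝ) ^ γ) := by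
  -- For `v = n ^ γ`, the power `v ^ (1 / γ + 1)` is `n * n ^ γ`.
  have h1 := (isLittleO_rpow_exp_pos_mul_atTop (1 / γ + 1) (Real.log_pos one_lt_two)).bound
    one_pos
  have h2 : Tendsto (fun n : ℕ => (n : ℝ) ^ γ) atTop atTop :=
    (tendsto_rpow_atTop hγ).comp tendsto_natCast_atTop_atTop
  filter_upwards [h2.eventually h1, eventually_gt_atTop 0] with n hn hpos
  have hn0 : (0 : ℝ) < n := by exact_mod_cast hpos
  have hu : 0 < (n : ℝ) ^ γ := by positivity
  rw [one_mul, Real.norm_of_nonneg (by positivity), Real.norm_of_nonneg (Real.exp_pos _).le,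
    Real.rpow_add_one hu.ne', ← Real.rpow_mul hn0.le, mul_one_div_cancel hγ.ne', Real.rpow_one] at hn
  rwa [Real.rpow_def_of_pos two_pos]

theorem two_mul_div_sq_mul_ceil_le {n u : ℝ} (hn0 : 0 < n) (hu4 : 4 ≤ u) :
    2 * ((n / u ^ 2) * (⌈u⌉₊ : ℝ)) ≤ n := by
  have hu0 : 0 < u := by linarith
  have hh2 : (⌈u⌉₊ : ℝ) ≤ u + 1 := (Nat.ceil_lt_add_one hu0.le).le
  calc 2 * ((n / u ^ 2) * (⌈u⌉₊ : ℝ)) ≤ 2 * ((n / u ^ 2) * (u + 1)) := by gcongr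
    _ = n * ((2 * (u + 1)) / u ^ 2) := by ring
    _ ≤ n * 1 := by
        gcongr
        rw [div_le_one (by positivity)]
        nlinarith
    _ = n := mul_one _

/-- The two kinds of luck have probability at most `1 / u` and `2 / u`, which dictates `τ ^ 2 = u /
3`. -/
theorem sq_sqrt_mul_le_one {n u : ℝ} (hu4 : 4 ≤ u) (htwo : n * u ≤ 2 ^ u) :
    √(u / 3) ^ 2 * (n / 2 ^ ⌈u⌉₊ + (⌈u⌉₊ : ℝ) / (⌈u ^ 2⌉₊ : ℝ)) ≤ 1 := by
  have hu0 : 0 < u := by linarith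
  have hh1 : u ≤ (⌈u⌉₊ : ℝ) := Nat.le_ceil u
  have hh2 : (⌈u⌉₊ : ℝ) ≤ u + 1 := (Nat.ceil_lt_add_one hu0.le).le
  have hm1 : u ^ 2 ≤ (⌈u ^ 2⌉₊ : ℝ) := Nat.le_ceil _
  have hτsq : √(u / 3) ^ 2 = u / 3 := Real.sq_sqrt (by positivity)
  have h1 : n / 2 ^ ⌈u⌉₊ ≤ 1 / u := by
    rw [div_le_div_iff₀ (by positivity) hu0, one_mul]
    refine htwo.trans ?_
    rw [← Real.rpow_natCast]
    exact Real.rpow_le_rpow_of_exponent_le one_le_two hh1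
  have h2 : (⌈u⌉₊ : ℝ) / (⌈u ^ 2⌉₊ : ℝ) ≤ 2 / u := by
    calc (⌈u⌉₊ : ℝ) / (⌈u ^ 2⌉₊ : ℝ) ≤ (u + 1) / u ^ 2 := by gcongr
      _ ≤ 2 / u := by
          rw [div_le_div_iff₀ (by positivity) hu0]
          nlinarith
  calc _ ≤ u / 3 * (1 / u + 2 / u) := by rw [hτsq]; gcongr
    _ = 1 := by field_simp; norm_num

/-- With `L = log₂ n`, one has `log₂ τ ≥ γ * L / 2 - 1`. Half of the main term exceeds `b`; the
rest, at least `3 * n` since `γ * L ≥ 12`, covers `2 * n + 1`. -/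
theorem two_pow_le_sqrt_pow {n b : ℕ} {γ : ℝ} (hγ : 0 < γ) (hn0 : (0 : ℝ) < n)
    (hL : 12 / γ ≤ Real.logb 2 n) (hlt : (b : ℝ) < γ / 4 * (n * Real.logb 2 n)) :
    (2 : ℝ) ^ (b + n + 1) ≤ √((n : ℝ) ^ γ / 3) ^ n := by
  have hn1 : (1 : ℝ) ≤ n := by exact_mod_cast (Nat.cast_pos.mp hn0 : 0 < n)
  set u : ℝ := (n : ℝ) ^ γ with hudef
  set L : ℝ := Real.logb 2 n with hLdef
  have hu0 : 0 < u := by positivity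
  have hτsq : √(u / 3) ^ 2 = u / 3 := Real.sq_sqrt (by positivity)
  have hlogτ : γ / 2 * L - 1 ≤ Real.logb 2 √(u / 3) := by
    have h1 : Real.logb 2 (√(u / 3) ^ 2) = 2 * Real.logb 2 √(u / 3) := by
      rw [Real.logb_pow]; norm_num
    have h2 : Real.logb 2 u = γ * L := by
      rw [hudef, hLdef, Real.logb_rpow_eq_mul_logb_of_pos hn0]
    have h3 : Real.logb 2 (u / 4) ≤ Real.logb 2 (u / 3) :=
      Real.logb_le_logb_of_le one_lt_two (by positivity) (by linarith)
    have h4 : Real.logb 2 4 = 2 := by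
      rw [show (4 : ℝ) = 2 ^ (2 : ℕ) by norm_num, Real.logb_pow]; norm_num
    rw [Real.logb_div hu0.ne' (by norm_num), h4] at h3
    rw [hτsq] at h1
    linarith
  have hτ0 : 0 < √(u / 3) := by positivity
  rw [← Real.logb_le_logb one_lt_two (by positivity) (by positivity), Real.logb_pow,
    Real.logb_pow, Real.logb_self_eq_one one_lt_two, mul_one]
  refine le_trans ?_ (mul_le_mul_of_nonneg_left hlogτ hn0.le)
  have h12 : 12 ≤ γ * L := by rwa [div_le_iff₀ hγ, mul_comm] at hL
  push_cast
  nlinarith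

/-- Multiply the competitive bound by `u ^ 4` and divide by `n`; as `u ^ 4 ≤ n`, the additive
constant stays bounded. -/
theorem sq_le_of_competitive {n u C c o α : ℝ} (hn0 : 0 < n) (hu1 : 1 ≤ u) (hu6n : u ^ 6 ≤ n)
    (hC : 0 < C) (hc : c ≤ C * (n / u ^ 6)) (ho0 : 0 ≤ o) (ho : o ≤ 4 * u ^ 2)
    (h : n / u ^ 2 / 2 ≤ c * o + α) : u ^ 2 ≤ 8 * C + 2 * |α| := by
  have hu0 : 0 < u := by linarith
  have h1 : c * o ≤ C * (n / u ^ 6) * (4 * u ^ 2) :=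
    mul_le_mul hc ho ho0 (by positivity)
  have h2 : n / u ^ 2 / 2 ≤ C * (n / u ^ 6) * (4 * u ^ 2) + |α| :=
    h.trans (add_le_add h1 (le_abs_self α))
  have h3 : n / u ^ 2 / 2 * u ^ 4 ≤ (C * (n / u ^ 6) * (4 * u ^ 2) + |α|) * u ^ 4 := by gcongr
  have h4 : n / u ^ 2 / 2 * u ^ 4 = n * (u ^ 2 / 2) := by field_simp
  have h5 : (C * (n / u ^ 6) * (4 * u ^ 2) + |α|) * u ^ 4 = 4 * C * n + |α| * u ^ 4 := by
    field_simp
  have h6 : |α| * u ^ 4 ≤ |α| * n := by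
    refine mul_le_mul_of_nonneg_left (le_trans ?_ hu6n) (abs_nonneg _)
    exact pow_le_pow_right₀ hu1 (by norm_num)
  have h7 : n * (u ^ 2 / 2) ≤ n * (4 * C + |α|) := by linarith
  have h8 := le_of_mul_le_mul_left h7 hn0
  linarith

/-- A competitive algorithm, for a ratio `O(n ^ (1 - 6 * γ))`, reads many bits of advice. -/
theorem eventually_advice_le {Ω : Type*} [MeasurableSpace Ω] {μ : Measure Ω}
    (R : RandomizedAlgorithm μ) {b : ℕ → ℕ} {c : ℕ → ℝ} (hR : R.HasAdviceComplexity b)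
    {γ : ℝ} (hγ : 0 < γ) (hγ6 : 6 * γ ≤ 1)
    (hc : c =O[atTop] (fun n : ℕ => (n : ℝ) ^ (1 - 6 * γ))) (hcomp : R.IsCompetitive c) :
    ∀ᶠ n : ℕ in atTop, γ / 4 * ((n : ℝ) * Real.logb 2 n) ≤ (b n : ℝ) := by
  obtain ⟨C, hC, hbound⟩ := hc.exists_pos
  obtain ⟨α, hα⟩ := hcomp
  have hu : Tendsto (fun n : ℕ => (n : ℝ) ^ γ) atTop atTop :=
    (tendsto_rpow_atTop hγ).comp tendsto_natCast_atTop_atTop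
  have hlog : Tendsto (fun n : ℕ => Real.logb 2 n) atTop atTop :=
    (Real.tendsto_logb_atTop one_lt_two).comp tendsto_natCast_atTop_atTop
  filter_upwards [hbound.bound, eventually_mul_rpow_le_two_rpow hγ, eventually_gt_atTop 0,
    hu.eventually_ge_atTop 4, hu.eventually_ge_atTop (8 * C + 2 * |α| + 1),
    hlog.eventually_ge_atTop (12 / γ)] with n hcn htwo hn hu4 hularge hL
  by_contra! hlt
  have hn0 : (0 : ℝ) < n := by exact_mod_cast hn
  have hn1 : (1 : ℝ) ≤ n := by exact_mod_cast hn
  set u : ℝ := (n : ℝ) ^ γ with hudef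
  have hu0 : 0 < u := by linarith
  have hu6 : u ^ 6 = (n : ℝ) ^ (6 * γ) := by
    rw [hudef, ← Real.rpow_natCast, ← Real.rpow_mul hn0.le]
    congr 1
    push_cast
    ring
  have hu6n : u ^ 6 ≤ n := by
    rw [hu6]
    simpa using Real.rpow_le_rpow_of_exponent_le hn1 hγ6
  have hm2 : (⌈u ^ 2⌉₊ : ℝ) ≤ u ^ 2 + 1 := (Nat.ceil_lt_add_one (by positivity)).le
  obtain ⟨z, hz⟩ := exists_large_expectedCost R hR (Nat.ceil_pos.mpr hu0)
    (Nat.ceil_pos.mpr (by positivity : 0 < u ^ 2)) (by positivity)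
    (two_mul_div_sq_mul_ceil_le hn0 hu4) (Real.one_le_sqrt.mpr (by linarith))
    (sq_sqrt_mul_le_one hu4 htwo) (two_pow_le_sqrt_pow hγ hn0 hL hlt)
  have hz2 := hz.trans (hα _ (isInput_inputOf z n))
  rw [length_inputOf] at hz2
  have hopt : (opt (inputOf z n) : ℝ) ≤ 4 * u ^ 2 := by
    have : (opt (inputOf z n) : ℝ) ≤ 2 * (⌈u ^ 2⌉₊ : ℝ) := by exact_mod_cast opt_inputOf_le z n
    nlinarith
  have hcn' : c n ≤ C * (n / u ^ 6) := by
    refine (le_abs_self _).trans (hcn.trans_eq ?_)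
    rw [Real.norm_of_nonneg (by positivity), Real.rpow_sub hn0, Real.rpow_one, hu6]
  -- The resulting bound on `u ^ 2` contradicts `u ^ 2 ≥ u ≥ 8 * C + 2 * |α| + 1`.
  have := sq_le_of_competitive hn0 (by linarith) hu6n hC hcn' (Nat.cast_nonneg _) hopt hz2
  nlinarith

end OnlineColoring

theorem theorem5 (ε : ℝ) (hε : 0 < ε) :
    ∃ K : ℝ, 0 < K ∧
      ∀ (Ω : Type*) [MeasurableSpace Ω] (μ : Measure Ω)
        (R : OnlineColoring.RandomizedAlgorithm μ) (b : ℕ → ℕ) (c : ℕ → ℝ),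
        R.HasAdviceComplexity b →
        c =O[atTop] (fun n : ℕ => (n : ℝ) ^ (1 - ε)) →
        R.IsCompetitive c →
        ∀ᶠ n : ℕ in atTop, K * ((n : ℝ) * Real.logb 2 n) ≤ (b n : ℝ) := by
  have hδ : 0 < min ε 1 := lt_min hε one_pos
  -- Here `γ = min ε 1 / 6` and `K = γ / 4`. Capping `ε` at `1` ensures `u ^ 6 ≤ n` and only weakens
  -- the assumption on `c`.
  refine ⟨min ε 1 / 6 / 4, by positivity, fun Ω _ μ R b c hR hc hcomp => ?_⟩
  have h6 : 6 * (min ε 1 / 6) = min ε 1 := by ring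
  refine OnlineColoring.eventually_advice_le R hR (by positivity) (h6.trans_le (min_le_right _ _))
    (hc.trans ?_) hcomp
  rw [h6]
  refine IsBigO.of_bound 1 ?_
  filter_upwards [eventually_ge_atTop 1] with n hn
  have hn1 : (1 : ℝ) ≤ n := by exact_mod_cast hn
  rw [one_mul, Real.norm_of_nonneg (by positivity), Real.norm_of_nonneg (by positivity)]
  exact Real.rpow_le_rpow_of_exponent_le hn1 (by linarith [min_le_left ε 1])
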